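/- Let \(k\ge 2\) and \(n\ge k^2-k+1\) be integers, and let \(G\) be a (simple, undirected) \(k\)-regular graph of order \(n\). Let \(\|G\|_*\) denote the energy of \(G\), that is, the sum of the absolute values of the eigenvalues (with multiplicity) of its adjacency matrix. Then \[ \|G\|_*\le\left(\sqrt{k-1}+\frac{1}{k+\sqrt{k-1}}\right)n . \] Equality holds if and only if \(G\) is a disjoint union of incidence graphs of projective planes of order \(k-1\) (the planes may be different), or \(k=2\) and \(G\) is a disjoint union of triangles and hexagons. Here the incidence graph of a projective plane is the bipartite graph whose vertices are the points and the lines of the plane, a point being adjacent to a line exactly when it lies on it. -/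

import Mathlib

universe u

/-- The energy of a finite graph: the sum of the absolute values of the eigenvalues, with
multiplicity, of its adjacency matrix. -/
noncomputable def SimpleGraph.energy {V : Type u} [Fintype V] [DecidableEq V]
    (G : SimpleGraph V) [DecidableRel G.Adj] : ℝ :=
  ∑ i, |(G.isHermitian_adjMatrix ℝ).eigenvalues i|

/-- The disjoint union of a family of graphs. -/
def SimpleGraph.disjointUnion {ι : Type u} {W : ι → Type u} (H : ∀ i, SimpleGraph (W i)) :
    SimpleGraph (Σ i, W i) where
  Adj x y := ∃ (i : ι) (a b : W i), x = ⟨i, a⟩ ∧ y = ⟨i, b⟩ ∧ (H i).Adj a b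
  symm := ⟨by
    rintro x y ⟨i, a, b, hx, hy, h⟩
    exact ⟨i, b, a, hy, hx, h.symm⟩⟩
  loopless := ⟨by
    rintro x ⟨i, a, b, rfl, hy, h⟩
    obtain rfl : a = b := eq_of_heq (Sigma.mk.inj hy).2
    exact h.ne rfl⟩

/-- `G` is (isomorphic to) a disjoint union of graphs that belong to the class `𝒞`. -/
def SimpleGraph.IsDisjointUnionOf {V : Type u} (𝒞 : ∀ W : Type u, SimpleGraph W → Prop)
    (G : SimpleGraph V) : Prop :=
  ∃ (ι : Type u) (W : ι → Type u) (H : ∀ i, SimpleGraph (W i)),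
    (∀ i, 𝒞 (W i) (H i)) ∧ Nonempty (G ≃g SimpleGraph.disjointUnion H)

/-- The incidence graph of points `P` and lines `L`: the bipartite graph on `P ⊕ L` in which a
point and a line are adjacent exactly when the point lies on the line. -/
def SimpleGraph.incidenceGraph (P L : Type u) [Membership P L] : SimpleGraph (P ⊕ L) where
  Adj x y := ∃ (p : P) (l : L), p ∈ l ∧
    ((x = Sum.inl p ∧ y = Sum.inr l) ∨ (x = Sum.inr l ∧ y = Sum.inl p))
  symm := ⟨by
    rintro x y ⟨p, l, h, h' | h'⟩
    · exact ⟨p, l, h, Or.inr ⟨h'.2, h'.1⟩⟩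
    · exact ⟨p, l, h, Or.inl ⟨h'.2, h'.1⟩⟩⟩
  loopless := ⟨by
    rintro x ⟨p, l, -, ⟨h₁, h₂⟩ | ⟨h₁, h₂⟩⟩
    · exact Sum.inl_ne_inr (h₁.symm.trans h₂)
    · exact Sum.inl_ne_inr (h₂.symm.trans h₁)⟩

/-- `H` is (isomorphic to) the incidence graph of a finite projective plane of order `q`.
Every projective plane has order at least `2` here; the degenerate plane of order `1`, the
triangle, is not counted as a projective plane. -/
def SimpleGraph.IsPlaneIncidenceGraph (q : ℕ) (W : Type u) (H : SimpleGraph W) : Prop :=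
  ∃ (P L : Type u) (_ : Finite P) (_ : Finite L) (_ : Membership P L)
    (_ : Configuration.ProjectivePlane P L),
    Configuration.ProjectivePlane.order P L = q ∧
      Nonempty (H ≃g SimpleGraph.incidenceGraph P L)

/-- `H` is a triangle or a hexagon. -/
def SimpleGraph.IsTriangleOrHexagon (W : Type u) (H : SimpleGraph W) : Prop :=
  Nonempty (H ≃g SimpleGraph.cycleGraph 3) ∨ Nonempty (H ≃g SimpleGraph.cycleGraph 6)

/-! Put s = √(k-1). The quartic (x-s)²(k-x)(x+2s+k) is nonnegative on [0,k] and has no cubic term,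
since its roots s, s, k, -(2s+k) add up to 0. Evaluating it at |λ| and summing over the spectrum
therefore involves only tr A² = nk, tr A⁴ and the energy. As tr A⁴ is the sum of the squared
codegrees c(u,v), and every row of codegrees sums to k², the result is the exact formula
`energy_identity`: a positive multiple of (bound - energy) equals the sum of the quartic's values
plus the sum of c(c-1) over u ≠ v. Both sums are nonnegative.

Equality thus means that all |λ| lie in {s, k} and that distinct vertices have at most one common
neighbour. Then M = A² - (k-1)I is the 0-1 matrix of `Linked`, with m = k²-k+1 ones in each row, and
the spectral condition becomes M² = mM, that is, transitivity of `Linked`.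

Adjacency carries linking classes to linking classes, so a connected component has at most two. With
one class, the friendship theorem forces k = 2 and a triangle. With two, the component is bipartite
and any two vertices of one part have a unique common neighbour: a projective plane if k ≥ 3, a
hexagon if k = 2. -/

open Polynomial in
theorem Matrix.IsHermitian.trace_aeval {ι : Type*} [Fintype ι] [DecidableEq ι]
    {A : Matrix ι ι ℝ} (hA : A.IsHermitian) (p : ℝ[X]) :
    (aeval A p).trace = ∑ i, p.eval (hA.eigenvalues i) := by
  have hdiag : aeval (Matrix.diagonal hA.eigenvalues) p =
      Matrix.diagonal fun i => p.eval (hA.eigenvalues i) := by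
    have h := Polynomial.aeval_algHom_apply (Matrix.diagonalAlgHom (n := ι) (α := ℝ) ℝ)
      hA.eigenvalues p
    simp only [Matrix.diagonalAlgHom_apply] at h
    rw [h]
    congr 1
    ext i
    have := Polynomial.aeval_algHom_apply (Pi.evalAlgHom ℝ (fun _ : ι => ℝ) i) hA.eigenvalues p
    exact this.symm
  have hspec := hA.spectral_theorem
  have h : aeval A p = Unitary.conjStarAlgAut ℝ _ hA.eigenvectorUnitary
      (aeval (Matrix.diagonal hA.eigenvalues) p) := by
    conv_lhs => rw [hspec]
    exact Polynomial.aeval_algHom_apply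
      (Unitary.conjStarAlgAut ℝ (Matrix ι ι ℝ) hA.eigenvectorUnitary) _ p
  rw [h, hdiag, Unitary.conjStarAlgAut_apply, Matrix.trace_mul_comm, ← mul_assoc]
  simp [Matrix.trace]

namespace SimpleGraph

variable {V : Type u}

/-- Two distinct vertices have at most one common neighbour. -/
def CommonNeighborUnique (G : SimpleGraph V) : Prop :=
  ∀ ⦃u v a b⦄, u ≠ v → G.Adj u a → G.Adj v a → G.Adj u b → G.Adj v b → a = b

/-- Two vertices are linked if they are equal or have a common neighbour. -/
def Linked (G : SimpleGraph V) (u v : V) : Prop :=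
  u = v ∨ ∃ a, G.Adj u a ∧ G.Adj v a

/-- Graphs in which distinct vertices have at most one common neighbour, and in which being linked
is an equivalence relation. -/
structure IsLocallyProjective (G : SimpleGraph V) : Prop where
  unique : G.CommonNeighborUnique
  trans : ∀ ⦃u v w⦄, G.Linked u v → G.Linked v w → G.Linked u w

theorem Linked.symm {G : SimpleGraph V} {u v : V} (h : G.Linked u v) : G.Linked v u := by
  rcases h with rfl | ⟨a, h1, h2⟩
  · exact Or.inl rfl
  · exact Or.inr ⟨a, h2, h1⟩

/-! ### The energy bound and its equality case in spectral form -/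

section Spectral

variable [Fintype V] [DecidableEq V] (G : SimpleGraph V) [DecidableRel G.Adj]

theorem adjMatrix_sq_apply (R : Type*) [Semiring R] (u v : V) :
    (G.adjMatrix R * G.adjMatrix R) u v =
      ((G.neighborFinset u ∩ G.neighborFinset v).card : R) := by
  rw [adjMatrix_mul_apply]
  simp only [adjMatrix_apply, Finset.sum_boole]
  congr 2
  ext a
  simp [G.adj_comm]

variable {G}

theorem commonNeighborUnique_iff_card_le_one :
    G.CommonNeighborUnique ↔
      ∀ u v, u ≠ v → (G.neighborFinset u ∩ G.neighborFinset v).card ≤ 1 := by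
  simp only [Finset.card_le_one, Finset.mem_inter, mem_neighborFinset]
  exact ⟨fun h u v huv a ha b hb => h huv ha.1 ha.2 hb.1 hb.2,
    fun h u v a b huv h1 h2 h3 h4 => h u v huv a ⟨h1, h2⟩ b ⟨h3, h4⟩⟩

variable {k : ℕ}

theorem IsRegularOfDegree.sum_card_inter_neighborFinset (hG : G.IsRegularOfDegree k) (u : V) :
    ∑ v, ((G.neighborFinset u ∩ G.neighborFinset v).card : ℝ) = k ^ 2 := by
  have h1 : ∀ v, ((G.neighborFinset u ∩ G.neighborFinset v).card : ℝ) =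
      ∑ a ∈ G.neighborFinset u, G.adjMatrix ℝ a v := by
    intro v
    rw [← adjMatrix_sq_apply, adjMatrix_mul_apply]
  simp_rw [h1]
  rw [Finset.sum_comm]
  have h2 : ∀ a, ∑ v, G.adjMatrix ℝ a v = k := by
    intro a
    have := adjMatrix_mulVec_const_apply_of_regular (a := (1 : ℝ)) hG (v := a)
    simpa [Matrix.mulVec, dotProduct] using this
  rw [Finset.sum_congr rfl fun a _ => h2 a, Finset.sum_const, card_neighborFinset_eq_degree,
    hG.degree_eq u, nsmul_eq_mul, sq]

/-- Gershgorin: the diagonal of A vanishes, so every disc is centred at 0, with radius at most the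
row sum k. -/
theorem IsRegularOfDegree.abs_eigenvalues_adjMatrix_le (hG : G.IsRegularOfDegree k) (i : V) :
    |(G.isHermitian_adjMatrix ℝ).eigenvalues i| ≤ k := by
  have h : Module.End.HasEigenvalue (Matrix.toLin' (G.adjMatrix ℝ))
      ((G.isHermitian_adjMatrix ℝ).eigenvalues i) := by
    apply Module.End.HasEigenvalue.of_mem_spectrum
    rw [Matrix.spectrum_toLin']
    exact (G.isHermitian_adjMatrix ℝ).eigenvalues_mem_spectrum_real i
  obtain ⟨a, ha⟩ := eigenvalue_mem_ball h
  rw [mem_closedBall_iff_norm, adjMatrix_apply, if_neg (G.loopless.irrefl a), sub_zero,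
    Real.norm_eq_abs] at ha
  refine ha.trans ?_
  calc ∑ j ∈ Finset.univ.erase a, ‖G.adjMatrix ℝ a j‖
      ≤ ∑ j, ‖G.adjMatrix ℝ a j‖ :=
        Finset.sum_le_sum_of_subset_of_nonneg (Finset.erase_subset _ _) fun _ _ _ => norm_nonneg _
    _ = ∑ j, G.adjMatrix ℝ a j := by
        refine Finset.sum_congr rfl fun j _ => ?_
        rw [adjMatrix_apply]
        split_ifs <;> simp
    _ = k := by
        have := adjMatrix_mulVec_const_apply_of_regular (a := (1 : ℝ)) hG (v := a)
        simpa [Matrix.mulVec, dotProduct] using this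

theorem IsRegularOfDegree.sum_eigenvalues_sq (hG : G.IsRegularOfDegree k) :
    ∑ i, (G.isHermitian_adjMatrix ℝ).eigenvalues i ^ 2 = Fintype.card V * k := by
  have h := (G.isHermitian_adjMatrix ℝ).trace_aeval (Polynomial.X ^ 2)
  simp only [map_pow, Polynomial.aeval_X, Polynomial.eval_pow, Polynomial.eval_X] at h
  rw [← h, sq, Matrix.trace]
  simp only [Matrix.diag_apply, adjMatrix_mul_self_apply_self, hG.degree_eq, Finset.sum_const,
    Finset.card_univ, nsmul_eq_mul]

theorem sum_eigenvalues_pow_four :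
    ∑ i, (G.isHermitian_adjMatrix ℝ).eigenvalues i ^ 4 =
      ∑ u, ∑ v, ((G.neighborFinset u ∩ G.neighborFinset v).card : ℝ) ^ 2 := by
  have h := (G.isHermitian_adjMatrix ℝ).trace_aeval (Polynomial.X ^ 4)
  simp only [map_pow, Polynomial.aeval_X, Polynomial.eval_pow, Polynomial.eval_X] at h
  rw [← h, show 4 = 2 * 2 by norm_num, pow_mul, sq, sq, Matrix.trace]
  refine Finset.sum_congr rfl fun u _ => ?_
  rw [Matrix.diag_apply, Matrix.mul_apply]
  refine Finset.sum_congr rfl fun v _ => ?_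
  rw [adjMatrix_sq_apply, adjMatrix_sq_apply, Finset.inter_comm, sq]

theorem IsRegularOfDegree.energy_identity (hG : G.IsRegularOfDegree k) (hk : 2 ≤ k) {s : ℝ}
    (hs : s = √((k : ℝ) - 1)) :
    2 * s * (k + s) ^ 2 * ((s + 1 / (k + s)) * Fintype.card V - G.energy) =
      ∑ i, (|(G.isHermitian_adjMatrix ℝ).eigenvalues i| - s) ^ 2 *
        ((k - |(G.isHermitian_adjMatrix ℝ).eigenvalues i|) *
          (|(G.isHermitian_adjMatrix ℝ).eigenvalues i| + 2 * s + k)) +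
      ∑ u, ∑ v ∈ Finset.univ.erase u,
        ((G.neighborFinset u ∩ G.neighborFinset v).card : ℝ) *
          ((G.neighborFinset u ∩ G.neighborFinset v).card - 1) := by
  have hk' : (2 : ℝ) ≤ k := by exact_mod_cast hk
  have hs2 : s ^ 2 = k - 1 := by rw [hs, Real.sq_sqrt (by linarith)]
  have hs0 : 0 ≤ s := hs ▸ Real.sqrt_nonneg _
  have h1 : ∀ i, (|(G.isHermitian_adjMatrix ℝ).eigenvalues i| - s) ^ 2 *
        ((k - |(G.isHermitian_adjMatrix ℝ).eigenvalues i|) *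
          (|(G.isHermitian_adjMatrix ℝ).eigenvalues i| + 2 * s + k)) =
      (-(G.isHermitian_adjMatrix ℝ).eigenvalues i ^ 4 +
        (k ^ 2 + 2 * k * s + 3 * s ^ 2) * (G.isHermitian_adjMatrix ℝ).eigenvalues i ^ 2 +
        s ^ 2 * (k ^ 2 + 2 * k * s)) -
        2 * s * (k + s) ^ 2 * |(G.isHermitian_adjMatrix ℝ).eigenvalues i| := by
    intro i
    generalize (G.isHermitian_adjMatrix ℝ).eigenvalues i = x
    have h2 : x ^ 2 = |x| ^ 2 := (sq_abs x).symm
    have h4 : x ^ 4 = |x| ^ 4 := by rw [show 4 = 2 * 2 by norm_num, pow_mul, h2, ← pow_mul]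
    rw [h4, h2]
    ring
  -- The sum of c(c-1) over all v is ∑ c² - k²; the removed term v = u has c = k and contributes
  -- k(k-1).
  have h2 : ∀ u, ∑ v ∈ Finset.univ.erase u,
        ((G.neighborFinset u ∩ G.neighborFinset v).card : ℝ) *
          ((G.neighborFinset u ∩ G.neighborFinset v).card - 1) =
      ∑ v, ((G.neighborFinset u ∩ G.neighborFinset v).card : ℝ) ^ 2 - (2 * k ^ 2 - k) := by
    intro u
    have h := Finset.sum_erase_add Finset.univ (fun v =>
        ((G.neighborFinset u ∩ G.neighborFinset v).card : ℝ) *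
          ((G.neighborFinset u ∩ G.neighborFinset v).card - 1)) (Finset.mem_univ u)
    have h' : ∑ v, ((G.neighborFinset u ∩ G.neighborFinset v).card : ℝ) *
          ((G.neighborFinset u ∩ G.neighborFinset v).card - 1) =
        ∑ v, ((G.neighborFinset u ∩ G.neighborFinset v).card : ℝ) ^ 2 - k ^ 2 := by
      rw [← hG.sum_card_inter_neighborFinset u, ← Finset.sum_sub_distrib]
      exact Finset.sum_congr rfl fun v _ => by ring
    rw [h'] at h
    simp only [Finset.inter_self, card_neighborFinset_eq_degree, hG.degree_eq u] at h
    linarith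
  rw [Finset.sum_congr rfl fun i _ => h1 i, Finset.sum_congr rfl fun u _ => h2 u,
    Finset.sum_sub_distrib, Finset.sum_sub_distrib, Finset.sum_add_distrib, Finset.sum_add_distrib,
    Finset.sum_neg_distrib, ← Finset.mul_sum, ← Finset.mul_sum, hG.sum_eigenvalues_sq,
    sum_eigenvalues_pow_four, energy]
  rw [← Finset.mul_sum]
  simp only [Finset.sum_const, Finset.card_univ, nsmul_eq_mul]
  have hne : (k : ℝ) + s ≠ 0 := by positivity
  -- The relation k = s² + 1 enters only here; it turns the constant terms into the slope s +
  -- 1/(k+s).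
  have hb : 2 * s * (k + s) ^ 2 * (s + 1 / (k + s)) =
      (k ^ 2 + 2 * k * s + 3 * s ^ 2) * k + s ^ 2 * (k ^ 2 + 2 * k * s) - (2 * k ^ 2 - k) := by
    have : (k : ℝ) = s ^ 2 + 1 := by linarith
    field_simp
    rw [this]
    ring
  linear_combination (Fintype.card V : ℝ) * hb

/-- Every term on the right of `energy_identity` is nonnegative, c(c-1) because c is a natural
number. Equality makes each term vanish. -/
theorem IsRegularOfDegree.energy_le_and_eq_iff (hG : G.IsRegularOfDegree k) (hk : 2 ≤ k) :
    G.energy ≤ (√((k : ℝ) - 1) + 1 / (k + √((k : ℝ) - 1))) * Fintype.card V ∧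
    (G.energy = (√((k : ℝ) - 1) + 1 / (k + √((k : ℝ) - 1))) * Fintype.card V ↔
      (∀ i, (|(G.isHermitian_adjMatrix ℝ).eigenvalues i| = √((k : ℝ) - 1) ∨
        |(G.isHermitian_adjMatrix ℝ).eigenvalues i| = k)) ∧ G.CommonNeighborUnique) := by
  obtain ⟨s, hs⟩ : ∃ s, s = √((k : ℝ) - 1) := ⟨_, rfl⟩
  have key := hG.energy_identity hk hs
  rw [← hs]
  have hk' : (2 : ℝ) ≤ k := by exact_mod_cast hk
  have hs0 : 0 < s := hs ▸ Real.sqrt_pos.2 (by linarith)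
  have hD : 0 < 2 * s * (k + s) ^ 2 := by positivity
  have hpos : ∀ i, 0 < |(G.isHermitian_adjMatrix ℝ).eigenvalues i| + 2 * s + k := fun i => by
    positivity
  have hA : ∀ i ∈ Finset.univ, 0 ≤ (|(G.isHermitian_adjMatrix ℝ).eigenvalues i| - s) ^ 2 *
        ((k - |(G.isHermitian_adjMatrix ℝ).eigenvalues i|) *
          (|(G.isHermitian_adjMatrix ℝ).eigenvalues i| + 2 * s + k)) := fun i _ =>
    mul_nonneg (sq_nonneg _) (mul_nonneg
      (sub_nonneg.2 (hG.abs_eigenvalues_adjMatrix_le i)) (hpos i).le)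
  have hc : ∀ c : ℕ, 0 ≤ (c : ℝ) * (c - 1) := by
    intro c
    rcases c with _ | c
    · simp
    · push_cast
      have : (0 : ℝ) ≤ c := c.cast_nonneg
      nlinarith
  have hB' : ∀ u, ∀ v ∈ Finset.univ.erase u,
        0 ≤ ((G.neighborFinset u ∩ G.neighborFinset v).card : ℝ) *
          ((G.neighborFinset u ∩ G.neighborFinset v).card - 1) := fun u v _ => hc _
  have hB : ∀ u ∈ Finset.univ, 0 ≤ ∑ v ∈ Finset.univ.erase u,
        ((G.neighborFinset u ∩ G.neighborFinset v).card : ℝ) *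
          ((G.neighborFinset u ∩ G.neighborFinset v).card - 1) := fun u _ =>
    Finset.sum_nonneg (hB' u)
  have hA0 := Finset.sum_nonneg hA
  have hB0 := Finset.sum_nonneg hB
  refine ⟨?_, ?_⟩
  · have := nonneg_of_mul_nonneg_right (key ▸ add_nonneg hA0 hB0) hD
    linarith
  · have h1 : G.energy = (s + 1 / (k + s)) * Fintype.card V ↔
        2 * s * (k + s) ^ 2 * ((s + 1 / (k + s)) * Fintype.card V - G.energy) = 0 := by
      rw [mul_eq_zero, or_iff_right hD.ne', sub_eq_zero, eq_comm]
    rw [h1, key, add_eq_zero_iff_of_nonneg hA0 hB0, Finset.sum_eq_zero_iff_of_nonneg hA,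
      Finset.sum_eq_zero_iff_of_nonneg hB, commonNeighborUnique_iff_card_le_one]
    refine and_congr ?_ ?_
    · simp only [Finset.mem_univ, true_imp_iff]
      refine forall_congr' fun i => ?_
      rw [mul_eq_zero, mul_eq_zero, or_iff_left (hpos i).ne', sq_eq_zero_iff, sub_eq_zero,
        sub_eq_zero, @eq_comm _ (k : ℝ)]
    · simp only [Finset.mem_univ, true_imp_iff]
      refine forall_congr' fun u => ?_
      rw [Finset.sum_eq_zero_iff_of_nonneg (hB' u)]
      simp only [Finset.mem_erase, Finset.mem_univ, and_true]
      refine forall_congr' fun v => ?_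
      rw [ne_comm]
      refine imp_congr_right fun _ => ?_
      rw [mul_eq_zero, sub_eq_zero]
      norm_cast
      omega

end Spectral

end SimpleGraph

/-! ### Equality as transitivity of linking -/

-- For B = p(A) symmetric, tr(BᵀB) = ∑ p(λ)², which vanishes only if B = 0. No diagonalization of B
-- is needed.
open Polynomial in
theorem Matrix.IsHermitian.aeval_eq_zero_iff {ι : Type*} [Fintype ι] [DecidableEq ι]
    {A : Matrix ι ι ℝ} (hA : A.IsHermitian) (p : ℝ[X]) (hp : (aeval A p).IsHermitian) :
    aeval A p = 0 ↔ ∀ i, p.eval (hA.eigenvalues i) = 0 := by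
  rw [← Matrix.trace_conjTranspose_mul_self_eq_zero_iff, hp.eq, ← sq, ← map_pow, hA.trace_aeval,
    Finset.sum_eq_zero_iff_of_nonneg fun i _ => by rw [eval_pow]; exact sq_nonneg _]
  simp

namespace SimpleGraph

variable {V : Type u} [Fintype V] [DecidableEq V] {G : SimpleGraph V} [DecidableRel G.Adj] {k : ℕ}

open Classical in
theorem IsRegularOfDegree.sq_sub_apply (hG : G.IsRegularOfDegree k) (h : G.CommonNeighborUnique)
    (u v : V) :
    (G.adjMatrix ℝ * G.adjMatrix ℝ - ((k : ℝ) - 1) • (1 : Matrix V V ℝ)) u v =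
      if G.Linked u v then 1 else 0 := by
  rw [Matrix.sub_apply, adjMatrix_sq_apply, Matrix.smul_apply, Matrix.one_apply, smul_eq_mul]
  by_cases huv : u = v
  · subst huv
    rw [Finset.inter_self, card_neighborFinset_eq_degree, hG.degree_eq, if_pos rfl,
      if_pos (show G.Linked u u from Or.inl rfl)]
    ring
  · have hle := commonNeighborUnique_iff_card_le_one.1 h u v huv
    rw [if_neg huv, mul_zero, sub_zero]
    split_ifs with hl
    · obtain ⟨a, ha⟩ := hl.resolve_left huv
      have : 0 < (G.neighborFinset u ∩ G.neighborFinset v).card :=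
        Finset.card_pos.2 ⟨a, by simpa using ha⟩
      exact_mod_cast (by omega : (G.neighborFinset u ∩ G.neighborFinset v).card = 1)
    · rw [Nat.cast_eq_zero, Finset.card_eq_zero, Finset.eq_empty_iff_forall_notMem]
      intro a ha
      exact hl (Or.inr ⟨a, by simpa using ha⟩)

open Classical in
theorem IsRegularOfDegree.card_linked (hG : G.IsRegularOfDegree k) (h : G.CommonNeighborUnique)
    (u : V) : ((Finset.univ.filter fun v => G.Linked u v).card : ℝ) = k ^ 2 - k + 1 := by
  have h1 : ∀ v, (if G.Linked u v then (1 : ℝ) else 0) =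
      ((G.neighborFinset u ∩ G.neighborFinset v).card : ℝ) - (k - 1) * if u = v then 1 else 0 := by
    intro v
    rw [← hG.sq_sub_apply h, Matrix.sub_apply, adjMatrix_sq_apply, Matrix.smul_apply,
      Matrix.one_apply, smul_eq_mul]
  rw [← Finset.sum_boole, Finset.sum_congr rfl fun v _ => h1 v, Finset.sum_sub_distrib,
    hG.sum_card_inter_neighborFinset, ← Finset.mul_sum, Finset.sum_ite_eq,
    if_pos (Finset.mem_univ u)]
  ring

open Classical Polynomial in
theorem IsRegularOfDegree.abs_eigenvalues_iff_linked_trans (hG : G.IsRegularOfDegree k)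
    (hk : 2 ≤ k) (h : G.CommonNeighborUnique) :
    (∀ i, (|(G.isHermitian_adjMatrix ℝ).eigenvalues i| = √((k : ℝ) - 1) ∨
      |(G.isHermitian_adjMatrix ℝ).eigenvalues i| = k)) ↔
    ∀ ⦃u v w⦄, G.Linked u v → G.Linked v w → G.Linked u w := by
  have hk' : (2 : ℝ) ≤ k := by exact_mod_cast hk
  obtain ⟨M, hM⟩ : ∃ M, M = G.adjMatrix ℝ * G.adjMatrix ℝ - ((k : ℝ) - 1) • (1 : Matrix V V ℝ) :=
    ⟨_, rfl⟩
  have hMapply := hG.sq_sub_apply h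
  rw [← hM] at hMapply
  set m : ℝ := k ^ 2 - k + 1 with hm
  -- This is y² - my at y = x² - (k-1), so p(A) = M² - mM. Since (k-1) + m = k², it factors as (x² -
  -- (k-1))(x² - k²).
  let p : ℝ[X] := (X ^ 2 - C ((k : ℝ) - 1)) * (X ^ 2 - C ((k : ℝ) - 1)) -
    C m * (X ^ 2 - C ((k : ℝ) - 1))
  have hpA : aeval (G.adjMatrix ℝ) p = M * M - m • M := by
    rw [hM, ← Algebra.algebraMap_eq_smul_one]
    simp only [p, aeval_sub, aeval_mul, aeval_X, aeval_C, sq, Algebra.smul_def]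
  have hMh : M.IsHermitian := by
    rw [Matrix.IsHermitian, Matrix.conjTranspose_eq_transpose_of_trivial]
    ext u v
    rw [Matrix.transpose_apply, hMapply, hMapply]
    exact if_congr ⟨Linked.symm, Linked.symm⟩ rfl rfl
  have hp : (aeval (G.adjMatrix ℝ) p).IsHermitian := by
    rw [hpA]
    have h1 : (M * M).IsHermitian := by
      rw [Matrix.IsHermitian, Matrix.conjTranspose_mul, hMh.eq]
    have h2 : (m • M).IsHermitian := by
      rw [Matrix.IsHermitian, Matrix.conjTranspose_smul, hMh.eq, star_trivial]
    exact h1.sub h2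
  have hev : ∀ x : ℝ, (|x| = √((k : ℝ) - 1) ∨ |x| = k) ↔ p.eval x = 0 := by
    intro x
    have : p.eval x = (x ^ 2 - (k - 1)) * (x ^ 2 - k ^ 2) := by
      simp only [p, hm, eval_sub, eval_mul, eval_pow, eval_X, eval_C]
      ring
    rw [this, mul_eq_zero, sub_eq_zero, sub_eq_zero, sq_eq_sq_iff_abs_eq_abs x k, Nat.abs_cast,
      ← sq_abs x]
    refine or_congr ?_ Iff.rfl
    rw [eq_comm, Real.sqrt_eq_iff_mul_self_eq (by linarith) (abs_nonneg x), sq]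
    exact eq_comm
  -- M² counts the w linked to both u and v. Writing m as the size of the linking class of u makes
  -- the vanishing of an entry a comparison of two finite sets.
  have happly : ∀ u v, (M * M - m • M) u v =
      (((Finset.univ.filter fun w => G.Linked u w).filter fun w => G.Linked w v).card : ℝ) -
        if G.Linked u v then ((Finset.univ.filter fun w => G.Linked u w).card : ℝ) else 0 := by
    intro u v
    rw [Matrix.sub_apply, Matrix.mul_apply, Matrix.smul_apply, hMapply, hG.card_linked h,
      smul_eq_mul, mul_ite, mul_one, mul_zero, Finset.filter_filter, ← Finset.sum_boole]
    congr 1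
    refine Finset.sum_congr rfl fun w _ => ?_
    rw [hMapply, hMapply, ite_and, ite_mul, one_mul, zero_mul]
  rw [forall_congr' fun i => hev _, ← (G.isHermitian_adjMatrix ℝ).aeval_eq_zero_iff p hp, hpA]
  constructor
  · intro h0 u v w huv hvw
    have h1 := happly v u
    rw [h0, Matrix.zero_apply, if_pos huv.symm, eq_comm, sub_eq_zero, Nat.cast_inj] at h1
    have := Finset.filter_eq_self.1 (Finset.eq_of_subset_of_card_le (Finset.filter_subset _ _) h1.ge)
      (x := w) (by simpa using hvw)
    exact this.symm
  · intro ht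
    ext u v
    rw [happly, Matrix.zero_apply, sub_eq_zero]
    split_ifs with huv
    · congr 2
      rw [Finset.filter_eq_self]
      intro w hw
      exact ht (Linked.symm (by simpa using hw)) huv
    · rw [Nat.cast_eq_zero, Finset.card_eq_zero, Finset.filter_eq_empty_iff]
      intro w hw hwv
      exact huv (ht (by simpa using hw) hwv)

theorem IsRegularOfDegree.energy_eq_iff (hG : G.IsRegularOfDegree k) (hk : 2 ≤ k) :
    G.energy = (√((k : ℝ) - 1) + 1 / (k + √((k : ℝ) - 1))) * Fintype.card V ↔
      G.IsLocallyProjective := by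
  rw [(hG.energy_le_and_eq_iff hk).2]
  constructor
  · rintro ⟨h1, h2⟩
    exact ⟨h2, (hG.abs_eigenvalues_iff_linked_trans hk h2).1 h1⟩
  · rintro ⟨h1, h2⟩
    exact ⟨(hG.abs_eigenvalues_iff_linked_trans hk h1).2 h2, h1⟩

end SimpleGraph

/-! ### The extremal graphs are locally projective -/

namespace SimpleGraph

variable {V : Type u} {W : Type*} {G : SimpleGraph V} {H : SimpleGraph W}

theorem Iso.linked_iff (f : G ≃g H) {u v : V} : H.Linked (f u) (f v) ↔ G.Linked u v := by
  refine or_congr f.injective.eq_iff ?_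
  rw [f.surjective.exists]
  simp only [f.map_adj_iff]

theorem IsLocallyProjective.of_iso (h : H.IsLocallyProjective) (f : G ≃g H) :
    G.IsLocallyProjective where
  unique _ _ _ _ huv h1 h2 h3 h4 := f.injective <|
    h.unique (f.injective.ne huv) (f.map_adj_iff.2 h1) (f.map_adj_iff.2 h2) (f.map_adj_iff.2 h3)
      (f.map_adj_iff.2 h4)
  trans _ _ _ h1 h2 := f.linked_iff.1 (h.trans (f.linked_iff.2 h1) (f.linked_iff.2 h2))

section DisjointUnion

variable {ι : Type u} {X : ι → Type u} {K : ∀ i, SimpleGraph (X i)}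

theorem disjointUnion_adj_mk {i : ι} {a : X i} {y : Σ i, X i} :
    (disjointUnion K).Adj ⟨i, a⟩ y ↔ ∃ b, y = ⟨i, b⟩ ∧ (K i).Adj a b := by
  constructor
  · rintro ⟨j, a', b, h, rfl, hab⟩
    cases h
    exact ⟨b, rfl, hab⟩
  · rintro ⟨b, rfl, hab⟩
    exact ⟨i, a, b, rfl, rfl, hab⟩

theorem disjointUnion_adj_mk_mk {i : ι} {a b : X i} :
    (disjointUnion K).Adj ⟨i, a⟩ ⟨i, b⟩ ↔ (K i).Adj a b := by
  rw [disjointUnion_adj_mk]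
  constructor
  · rintro ⟨b', h, hab⟩
    cases h
    exact hab
  · exact fun h => ⟨b, rfl, h⟩

theorem disjointUnion_linked_mk {i : ι} {a : X i} {y : Σ i, X i} :
    (disjointUnion K).Linked ⟨i, a⟩ y ↔ ∃ b, y = ⟨i, b⟩ ∧ (K i).Linked a b := by
  constructor
  · rintro (rfl | ⟨c, h1, h2⟩)
    · exact ⟨a, rfl, Or.inl rfl⟩
    · obtain ⟨c, rfl, h1'⟩ := disjointUnion_adj_mk.1 h1
      obtain ⟨b, rfl, h2'⟩ := disjointUnion_adj_mk.1 h2.symm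
      exact ⟨b, rfl, Or.inr ⟨c, h1', h2'.symm⟩⟩
  · rintro ⟨b, rfl, rfl | ⟨c, h1, h2⟩⟩
    · exact Or.inl rfl
    · exact Or.inr ⟨⟨i, c⟩, disjointUnion_adj_mk_mk.2 h1, disjointUnion_adj_mk_mk.2 h2⟩

theorem IsLocallyProjective.disjointUnion (h : ∀ i, (K i).IsLocallyProjective) :
    (disjointUnion K).IsLocallyProjective where
  unique := by
    rintro ⟨i, u⟩ v a b huv h1 h2 h3 h4
    obtain ⟨a, rfl, h1'⟩ := disjointUnion_adj_mk.1 h1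
    obtain ⟨b, rfl, h3'⟩ := disjointUnion_adj_mk.1 h3
    obtain ⟨v, rfl, h2'⟩ := disjointUnion_adj_mk.1 h2.symm
    rw [(h i).unique (fun h => huv (by rw [h])) h1' h2'.symm h3' (disjointUnion_adj_mk_mk.1 h4)]
  trans := by
    rintro ⟨i, u⟩ v w h1 h2
    obtain ⟨v, rfl, h1'⟩ := disjointUnion_linked_mk.1 h1
    obtain ⟨w, rfl, h2'⟩ := disjointUnion_linked_mk.1 h2
    exact disjointUnion_linked_mk.2 ⟨w, rfl, (h i).trans h1' h2'⟩

theorem IsDisjointUnionOf.isLocallyProjective {𝒞 : ∀ W : Type u, SimpleGraph W → Prop}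
    (h : G.IsDisjointUnionOf 𝒞) (h𝒞 : ∀ W K, 𝒞 W K → K.IsLocallyProjective) :
    G.IsLocallyProjective := by
  obtain ⟨ι, X, K, hK, ⟨f⟩⟩ := h
  exact (IsLocallyProjective.disjointUnion fun i => h𝒞 _ _ (hK i)).of_iso f

end DisjointUnion

section Incidence

variable {P L : Type u} [Membership P L]

theorem incidenceGraph_adj_inl {p : P} {y : P ⊕ L} :
    (incidenceGraph P L).Adj (Sum.inl p) y ↔ ∃ l, p ∈ l ∧ y = Sum.inr l := by
  constructor
  · rintro ⟨p', l, h, ⟨h1, rfl⟩ | ⟨h1, -⟩⟩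
    · cases h1
      exact ⟨l, h, rfl⟩
    · cases h1
  · rintro ⟨l, h, rfl⟩
    exact ⟨p, l, h, Or.inl ⟨rfl, rfl⟩⟩

theorem incidenceGraph_adj_inr {l : L} {y : P ⊕ L} :
    (incidenceGraph P L).Adj (Sum.inr l) y ↔ ∃ p, p ∈ l ∧ y = Sum.inl p := by
  constructor
  · rintro ⟨p, l', h, ⟨h1, -⟩ | ⟨h1, rfl⟩⟩
    · cases h1
    · cases h1
      exact ⟨p, h, rfl⟩
  · rintro ⟨p, h, rfl⟩
    exact ⟨p, l, h, Or.inr ⟨rfl, rfl⟩⟩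

theorem incidenceGraph_linked_iff [Configuration.ProjectivePlane P L] {x y : P ⊕ L} :
    (incidenceGraph P L).Linked x y ↔ (x.isLeft = y.isLeft) := by
  constructor
  · rintro (rfl | ⟨a, h1, h2⟩)
    · rfl
    · rcases x with p | l <;> rcases y with q | m
      · rfl
      · obtain ⟨_, _, rfl⟩ := incidenceGraph_adj_inl.1 h1
        obtain ⟨_, _, h⟩ := incidenceGraph_adj_inr.1 h2
        cases h
      · obtain ⟨_, _, rfl⟩ := incidenceGraph_adj_inr.1 h1
        obtain ⟨_, _, h⟩ := incidenceGraph_adj_inl.1 h2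
        cases h
      · rfl
  · intro h
    by_cases hxy : x = y
    · exact Or.inl hxy
    · right
      rcases x with p | l <;> rcases y with q | m <;> simp at h hxy
      · have := Configuration.HasLines.mkLine_ax (L := L) hxy
        exact ⟨_, incidenceGraph_adj_inl.2 ⟨_, this.1, rfl⟩,
          incidenceGraph_adj_inl.2 ⟨_, this.2, rfl⟩⟩
      · have := Configuration.HasPoints.mkPoint_ax (P := P) hxy
        exact ⟨_, incidenceGraph_adj_inr.2 ⟨_, this.1, rfl⟩,
          incidenceGraph_adj_inr.2 ⟨_, this.2, rfl⟩⟩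

theorem isLocallyProjective_incidenceGraph [Configuration.ProjectivePlane P L] :
    (incidenceGraph P L).IsLocallyProjective where
  unique := by
    rintro (p | l) (q | m) a b huv h1 h2 h3 h4
    · obtain ⟨a, h1', rfl⟩ := incidenceGraph_adj_inl.1 h1
      obtain ⟨b, h3', rfl⟩ := incidenceGraph_adj_inl.1 h3
      obtain ⟨_, h2, h⟩ := incidenceGraph_adj_inl.1 h2
      cases h
      obtain ⟨_, h4, h⟩ := incidenceGraph_adj_inl.1 h4
      cases h
      rcases Configuration.Nondegenerate.eq_or_eq h1' h2 h3' h4 with h | h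
      · exact absurd (congrArg Sum.inl h) huv
      · rw [h]
    · obtain ⟨_, _, rfl⟩ := incidenceGraph_adj_inl.1 h1
      obtain ⟨_, _, h⟩ := incidenceGraph_adj_inr.1 h2
      cases h
    · obtain ⟨_, _, rfl⟩ := incidenceGraph_adj_inr.1 h1
      obtain ⟨_, _, h⟩ := incidenceGraph_adj_inl.1 h2
      cases h
    · obtain ⟨a, h1', rfl⟩ := incidenceGraph_adj_inr.1 h1
      obtain ⟨b, h3', rfl⟩ := incidenceGraph_adj_inr.1 h3
      obtain ⟨_, h2, h⟩ := incidenceGraph_adj_inr.1 h2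
      cases h
      obtain ⟨_, h4, h⟩ := incidenceGraph_adj_inr.1 h4
      cases h
      rcases Configuration.Nondegenerate.eq_or_eq h1' h3' h2 h4 with h | h
      · rw [h]
      · exact absurd (congrArg Sum.inr h) huv
  trans u v w h1 h2 := by
    rw [incidenceGraph_linked_iff] at *
    exact h1.trans h2

end Incidence

theorem IsPlaneIncidenceGraph.isLocallyProjective {q : ℕ} (h : IsPlaneIncidenceGraph q W H) :
    H.IsLocallyProjective := by
  obtain ⟨P, L, _, _, _, _, -, ⟨f⟩⟩ := h
  exact isLocallyProjective_incidenceGraph.of_iso f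

theorem isLocallyProjective_cycleGraph_three : (cycleGraph 3).IsLocallyProjective := by
  refine ⟨?_, ?_⟩
  · unfold CommonNeighborUnique
    decide
  · unfold Linked
    decide

theorem isLocallyProjective_cycleGraph_six : (cycleGraph 6).IsLocallyProjective := by
  refine ⟨?_, ?_⟩
  · unfold CommonNeighborUnique
    decide +kernel
  · unfold Linked
    decide +kernel

end SimpleGraph

/-! ### Recognizing projective planes -/

theorem Set.exists_mem_ne_ne_of_two_lt_ncard {α : Type*} {s : Set α} (h : 2 < s.ncard) (a b : α) :
    ∃ x ∈ s, x ≠ a ∧ x ≠ b := by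
  by_contra! hc
  have hs : s ⊆ {a, b} := fun x hx => by
    by_cases hxa : x = a
    · exact Or.inl hxa
    · exact Or.inr (hc x hx hxa)
  have h1 := Set.ncard_le_ncard hs
  have h2 := Set.ncard_insert_le a {b}
  rw [Set.ncard_singleton] at h2
  omega

/-- A finite configuration with unique joining lines and intersection points in which all lines
have `k ≥ 3` points and all points are on `k` lines is a projective plane of order `k - 1`. -/
theorem Configuration.exists_projectivePlane {P L : Type*} [Finite P] [Finite L] [Membership P L]
    [Nonempty P] {k : ℕ} (hk : 3 ≤ k)
    (hline : ∀ p q : P, p ≠ q → ∃ l : L, p ∈ l ∧ q ∈ l)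
    (hpoint : ∀ l m : L, l ≠ m → ∃ p : P, p ∈ l ∧ p ∈ m)
    (huniq : ∀ (p q : P) (l m : L), p ∈ l → q ∈ l → p ∈ m → q ∈ m → p = q ∨ l = m)
    (hlines : ∀ p : P, {l : L | p ∈ l}.ncard = k)
    (hpoints : ∀ l : L, {p : P | p ∈ l}.ncard = k) :
    ∃ _ : Configuration.ProjectivePlane P L, Configuration.ProjectivePlane.order P L = k - 1 := by
  have hL : ∀ (p : P) (a b : L), ∃ l : L, p ∈ l ∧ l ≠ a ∧ l ≠ b := fun p =>
    Set.exists_mem_ne_ne_of_two_lt_ncard (s := {l : L | p ∈ l}) (by rw [hlines p]; omega)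
  have hP : ∀ (l : L) (a b : P), ∃ p : P, p ∈ l ∧ p ≠ a ∧ p ≠ b := fun l =>
    Set.exists_mem_ne_ne_of_two_lt_ncard (s := {p : P | p ∈ l}) (by rw [hpoints l]; omega)
  have hnd1 : ∀ l : L, ∃ p : P, p ∉ l := fun l => by
    obtain ⟨p, hp, -⟩ : ∃ p : P, p ∈ l ∧ True := by
      obtain ⟨x⟩ := ‹Nonempty P›
      obtain ⟨p, hp, -⟩ := hP l x x
      exact ⟨p, hp, trivial⟩
    obtain ⟨m, hm, hml, -⟩ := hL p l l
    obtain ⟨q, hq, hqp, -⟩ := hP m p p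
    exact ⟨q, fun hql => (huniq p q l m hp hql hm hq).elim hqp.symm hml.symm⟩
  have hnd2 : ∀ p : P, ∃ l : L, p ∉ l := fun p => by
    obtain ⟨l, hl, -⟩ : ∃ l : L, p ∈ l ∧ True := by
      have hne : {l : L | p ∈ l}.ncard ≠ 0 := by rw [hlines p]; omega
      obtain ⟨l, hl⟩ := Set.nonempty_of_ncard_ne_zero hne
      exact ⟨l, hl, trivial⟩
    obtain ⟨q, hq, hqp, -⟩ := hP l p p
    obtain ⟨m, hm, hml, -⟩ := hL q l l
    exact ⟨m, fun hpm => (huniq p q l m hl hq hpm hm).elim hqp.symm hml.symm⟩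
  -- Take three lines `l₂`, `l₃`, `l'` through `p₂`, then `p₃` on `l₂` and `p₁` on `l'`, both other
  -- than `p₂`. A third line `l₁` through `p₁` avoids the joins of `p₁` with `p₂` and `p₃`; here k ≥
  -- 3 is essential.
  have hconfig : ∃ (p₁ p₂ p₃ : P) (l₁ l₂ l₃ : L), p₁ ∉ l₂ ∧ p₁ ∉ l₃ ∧ p₂ ∉ l₁ ∧ p₂ ∈ l₂ ∧ p₂ ∈ l₃ ∧
      p₃ ∉ l₁ ∧ p₃ ∈ l₂ ∧ p₃ ∉ l₃ := by
    obtain ⟨p₂⟩ := ‹Nonempty P›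
    obtain ⟨l₀, -⟩ := hnd2 p₂
    obtain ⟨l₂, h22, -⟩ := hL p₂ l₀ l₀
    obtain ⟨l₃, h23, h32, -⟩ := hL p₂ l₂ l₂
    obtain ⟨l', h2', h'2, h'3⟩ := hL p₂ l₂ l₃
    obtain ⟨p₃, hp3, hp32, -⟩ := hP l₂ p₂ p₂
    obtain ⟨p₁, hp1, hp12, -⟩ := hP l' p₂ p₂
    have h12 : p₁ ∉ l₂ := fun h => (huniq p₂ p₁ l₂ l' h22 h h2' hp1).elim hp12.symm h'2.symm
    have h13 : p₁ ∉ l₃ := fun h => (huniq p₂ p₁ l₃ l' h23 h h2' hp1).elim hp12.symm h'3.symm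
    have h33 : p₃ ∉ l₃ := fun h => (huniq p₂ p₃ l₃ l₂ h23 h h22 hp3).elim hp32.symm h32
    obtain ⟨m₂, hm1, hm2⟩ := hline p₁ p₂ hp12
    have hp13 : p₁ ≠ p₃ := fun h => h12 (h ▸ hp3)
    obtain ⟨m₃, hm3, hm4⟩ := hline p₁ p₃ hp13
    obtain ⟨l₁, hl1, hl2, hl3⟩ := hL p₁ m₂ m₃
    exact ⟨p₁, p₂, p₃, l₁, l₂, l₃, h12, h13,
      fun h => (huniq p₁ p₂ l₁ m₂ hl1 h hm1 hm2).elim hp12 hl2, h22, h23,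
      fun h => (huniq p₁ p₃ l₁ m₃ hl1 h hm3 hm4).elim hp13 hl3, hp3, h33⟩
  choose f hf using hline
  choose g hg using hpoint
  let hplane : Configuration.ProjectivePlane P L :=
    { exists_point := hnd1
      exists_line := hnd2
      eq_or_eq := huniq _ _ _ _
      mkPoint := fun h => g _ _ h
      mkPoint_ax := fun h => hg _ _ h
      mkLine := fun h => f _ _ h
      mkLine_ax := fun h => hf _ _ h
      exists_config := hconfig }
  refine ⟨hplane, ?_⟩
  obtain ⟨p⟩ := ‹Nonempty P›
  have h1 := Configuration.ProjectivePlane.lineCount_eq (L := L) p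
  have h2 : Configuration.lineCount L p = k := hlines p
  omega

/-! ### Classification of connected locally projective graphs -/

namespace SimpleGraph

variable {V : Type u} {G : SimpleGraph V} {k : ℕ}

/-- Neighbours of one vertex are linked. If d is a common neighbour of x and a, then y and d are
linked through x, and d and b through a. -/
theorem IsLocallyProjective.linked_of_adj (h : G.IsLocallyProjective) {x y a b : V}
    (hxa : G.Linked x a) (hxy : G.Adj x y) (hab : G.Adj a b) : G.Linked y b := by
  have hy : ∀ {z c d : V}, G.Adj z c → G.Adj z d → G.Linked c d :=
    fun h1 h2 => Or.inr ⟨_, h1.symm, h2.symm⟩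
  rcases hxa with rfl | ⟨d, h1, h2⟩
  · exact hy hxy hab
  · exact h.trans (hy hxy h1) (hy h2 hab)

theorem Connected.forall_mem_of_adj (hG : G.Connected) {S : Set V} {v : V} (hv : v ∈ S)
    (hS : ∀ ⦃a b⦄, a ∈ S → G.Adj a b → b ∈ S) (w : V) : w ∈ S := by
  obtain ⟨p⟩ := hG.preconnected v w
  induction p with
  | nil => exact hv
  | cons hadj _ ih => exact ih (hS hv hadj)

/-- The **friendship theorem** for regular graphs. -/
theorem IsRegularOfDegree.eq_two_of_friendship [Fintype V] [DecidableEq V] [Nonempty V]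
    [DecidableRel G.Adj] (hG : G.IsRegularOfDegree k) (hk : 2 ≤ k) (h : G.CommonNeighborUnique)
    (hl : ∀ u v, G.Linked u v) : k = 2 := by
  by_contra hne
  -- Modulo a prime p dividing k-1, A² = J (all ones) and AJ = J, so Aᵖ = J. But tr Aᵖ = (tr A)ᵖ =
  -- 0, whereas tr J = |V| = 1, the last equality because J² is both |V|J and J.
  obtain ⟨p, hp, hpk⟩ := Nat.exists_prime_and_dvd (show k - 1 ≠ 1 by omega)
  have : Fact p.Prime := ⟨hp⟩
  have hk1 : (k : ZMod p) = 1 := by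
    have h1 := (ZMod.natCast_eq_zero_iff _ _).2 hpk
    rw [Nat.cast_sub (by omega), Nat.cast_one] at h1
    exact sub_eq_zero.1 h1
  let J : Matrix V V (ZMod p) := Matrix.of fun _ _ => 1
  have hAA : G.adjMatrix (ZMod p) * G.adjMatrix (ZMod p) = J := by
    ext u v
    rw [adjMatrix_sq_apply]
    change _ = (1 : ZMod p)
    by_cases huv : u = v
    · rw [huv, Finset.inter_self, card_neighborFinset_eq_degree, hG.degree_eq, hk1]
    · obtain ⟨a, ha⟩ := (hl u v).resolve_left huv
      have h1 := commonNeighborUnique_iff_card_le_one.1 h u v huv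
      have h2 : 0 < (G.neighborFinset u ∩ G.neighborFinset v).card :=
        Finset.card_pos.2 ⟨a, by simpa using ha⟩
      rw [show (G.neighborFinset u ∩ G.neighborFinset v).card = 1 by omega, Nat.cast_one]
  have hAJ : G.adjMatrix (ZMod p) * J = J := by
    ext u v
    rw [adjMatrix_mul_apply]
    change ∑ _ ∈ G.neighborFinset u, (1 : ZMod p) = 1
    rw [Finset.sum_const, card_neighborFinset_eq_degree, hG.degree_eq, nsmul_eq_mul, hk1, mul_one]
  have hpow : ∀ j, G.adjMatrix (ZMod p) ^ (j + 2) = J := by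
    intro j
    induction j with
    | zero => rw [zero_add, sq, hAA]
    | succ j ih => rw [show j + 1 + 2 = (j + 2) + 1 by ring, pow_succ', ih, hAJ]
  have hcard : (Fintype.card V : ZMod p) = 1 := by
    obtain ⟨v⟩ := ‹Nonempty V›
    have h1 : J * J = J := by
      nth_rewrite 1 [← hAA]
      rw [mul_assoc, hAJ, hAJ]
    have h2 := congrFun (congrFun h1 v) v
    rw [Matrix.mul_apply] at h2
    simpa [J] using h2
  have htr := ZMod.trace_pow_card (G.adjMatrix (ZMod p))
  obtain ⟨j, rfl⟩ : ∃ j, p = j + 2 := ⟨p - 2, by have := hp.two_le; omega⟩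
  rw [hpow, trace_adjMatrix, zero_pow (by omega)] at htr
  have : J.trace = Fintype.card V := by simp [J, Matrix.trace]
  rw [this, hcard] at htr
  exact one_ne_zero htr

/-- In a graph with a bipartition into two parts `S`, `T` of pairwise linked vertices which is
regular of degree at least three, the parts are the points and the lines of a projective plane. -/
theorem IsLocallyProjective.isPlaneIncidenceGraph [Finite V] (h : G.IsLocallyProjective)
    (hG : ∀ v, (G.neighborSet v).ncard = k) (hk : 3 ≤ k) {S T : Set V} (hST : IsCompl S T)
    (hne : S.Nonempty) (hS : ∀ ⦃a b⦄, a ∈ S → G.Adj a b → b ∈ T)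
    (hT : ∀ ⦃a b⦄, a ∈ T → G.Adj a b → b ∈ S) (hSl : ∀ ⦃a b⦄, a ∈ S → b ∈ S → G.Linked a b)
    (hTl : ∀ ⦃a b⦄, a ∈ T → b ∈ T → G.Linked a b) : IsPlaneIncidenceGraph (k - 1) V G := by
  let mem : Membership S T := ⟨fun l p => G.Adj p.1 l.1⟩
  have : Nonempty S := hne.to_subtype
  have hdisj : ∀ {x}, x ∈ S → x ∉ T := fun h1 h2 => Set.disjoint_left.1 hST.disjoint h1 h2
  obtain ⟨hplane, horder⟩ := Configuration.exists_projectivePlane (P := S) (L := T) hk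
    (fun p q hpq => by
      obtain ⟨a, h1, h2⟩ := (hSl p.2 q.2).resolve_left (fun h => hpq (Subtype.ext h))
      exact ⟨⟨a, hS p.2 h1⟩, h1, h2⟩)
    (fun l m hlm => by
      obtain ⟨a, h1, h2⟩ := (hTl l.2 m.2).resolve_left (fun h => hlm (Subtype.ext h))
      exact ⟨⟨a, hT l.2 h1⟩, h1.symm, h2.symm⟩)
    (fun p q l m h1 h2 h3 h4 => by
      by_cases hpq : p = q
      · exact Or.inl hpq
      · exact Or.inr (Subtype.ext (h.unique (fun h => hpq (Subtype.ext h)) h1 h2 h3 h4)))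
    (fun p => by
      rw [← hG p.1, ← Set.ncard_image_of_injective _ Subtype.val_injective]
      congr 1
      ext x
      constructor
      · rintro ⟨l, hl, rfl⟩
        exact hl
      · exact fun hx => ⟨⟨x, hS p.2 hx⟩, hx, rfl⟩)
    (fun l => by
      rw [← hG l.1, ← Set.ncard_image_of_injective _ Subtype.val_injective]
      congr 1
      ext x
      constructor
      · rintro ⟨p, hp, rfl⟩
        exact G.symm.symm _ _ hp
      · exact fun hx => ⟨⟨x, hT l.2 hx⟩, G.symm.symm _ _ hx, rfl⟩)
  classical
  refine ⟨S, T, inferInstance, inferInstance, mem, hplane, horder, ⟨?_⟩⟩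
  let e : S ⊕ T ≃ V := Equiv.Set.sumCompl S |>.symm.trans
    ((Equiv.sumCongr (Equiv.refl _) (Equiv.setCongr hST.compl_eq))) |>.symm
  refine Iso.symm ⟨e, ?_⟩
  rintro (p | l) y
  · rw [incidenceGraph_adj_inl]
    change G.Adj p.1 (e y) ↔ _
    constructor
    · intro h1
      rcases y with q | m
      · exact absurd (hS p.2 h1) (hdisj q.2)
      · exact ⟨m, h1, rfl⟩
    · rintro ⟨m, h1, rfl⟩
      exact h1
  · rw [incidenceGraph_adj_inr]
    change G.Adj l.1 (e y) ↔ _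
    constructor
    · intro h1
      rcases y with q | m
      · exact ⟨q, h1.symm, rfl⟩
      · exact absurd m.2 (hdisj (hT l.2 h1))
    · rintro ⟨m, h1, rfl⟩
      exact G.symm.symm _ _ h1

theorem neighborSet_eq_pair {v a b : V} (hv : (G.neighborSet v).ncard = 2) (hab : a ≠ b)
    (ha : G.Adj v a) (hb : G.Adj v b) (x : V) : G.Adj v x ↔ x = a ∨ x = b := by
  have hfin : (G.neighborSet v).Finite := Set.finite_of_ncard_ne_zero (by omega)
  have hsub : ({a, b} : Set V) ⊆ G.neighborSet v := by
    rintro x (rfl | rfl)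
    · exact ha
    · exact hb
  have := Set.eq_of_subset_of_ncard_le hsub (by rw [hv, Set.ncard_pair hab]) hfin
  exact (Set.ext_iff.1 this x).symm

theorem exists_adj_ne {v a : V} (hv : (G.neighborSet v).ncard = 2) : ∃ b, b ≠ a ∧ G.Adj v b := by
  by_contra! hc
  have hsub : G.neighborSet v ⊆ {a} := fun x hx => by
    by_contra hne
    exact hc x hne hx
  have := Set.ncard_le_ncard hsub
  rw [Set.ncard_singleton] at this
  omega

/-- A common neighbour of two adjacent vertices closes a triangle; degree two leaves no further
edges, so connectedness exhausts the graph. -/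
theorem Connected.nonempty_iso_cycleGraph_three (hconn : G.Connected) (hG : ∀ v, (G.neighborSet v).ncard = 2)
    (hl : ∀ u v, G.Linked u v) : Nonempty (G ≃g cycleGraph 3) := by
  obtain ⟨u⟩ := hconn.nonempty
  obtain ⟨v, -, huv⟩ := exists_adj_ne (a := u) (hG u)
  obtain ⟨w, huw, hvw⟩ := (hl u v).resolve_left huv.ne
  have hu := neighborSet_eq_pair (hG u) hvw.ne huv huw
  have hv := neighborSet_eq_pair (hG v) huw.ne huv.symm hvw
  have hw := neighborSet_eq_pair (hG w) huv.ne huw.symm hvw.symm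
  have hall := hconn.forall_mem_of_adj (S := {u, v, w}) (v := u) (by simp) (by
    rintro a b (rfl | rfl | rfl) hab
    · rcases (hu b).1 hab with rfl | rfl <;> simp
    · rcases (hv b).1 hab with rfl | rfl <;> simp
    · rcases (hw b).1 hab with rfl | rfl <;> simp)
  have h1 := huv.ne
  have h2 := huw.ne
  have h3 := hvw.ne
  refine ⟨Iso.symm ⟨Equiv.ofBijective ![u, v, w] ⟨?_, ?_⟩, ?_⟩⟩
  · intro i j
    fin_cases i <;> fin_cases j <;> simp [h1, h2, h3, h1.symm, h2.symm, h3.symm]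
  · intro x
    rcases hall x with rfl | rfl | rfl
    exacts [⟨0, rfl⟩, ⟨1, rfl⟩, ⟨2, rfl⟩]
  · intro i j
    change G.Adj (![u, v, w] i) (![u, v, w] j) ↔ _
    fin_cases i <;> fin_cases j <;> simp [hu, hv, hw, h1, h2, h3, h1.symm, h2.symm, h3.symm] <;>
      decide

theorem IsLocallyProjective.nonempty_iso_cycleGraph_six (hconn : G.Connected)
    (h : G.IsLocallyProjective) (hG : ∀ v, (G.neighborSet v).ncard = 2) {S T : Set V}
    (hST : Disjoint S T) (hne : S.Nonempty) (hS : ∀ ⦃a b⦄, a ∈ S → G.Adj a b → b ∈ T)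
    (hT : ∀ ⦃a b⦄, a ∈ T → G.Adj a b → b ∈ S) (hSl : ∀ ⦃a b⦄, a ∈ S → b ∈ S → G.Linked a b) :
    Nonempty (G ≃g cycleGraph 6) := by
  have hdisj : ∀ {x y}, x ∈ S → y ∈ T → x ≠ y := fun h1 h2 h =>
    Set.disjoint_left.1 hST h1 (h ▸ h2)
  obtain ⟨p₀, hp₀⟩ := hne
  obtain ⟨l₀, -, hpl00⟩ := exists_adj_ne (a := p₀) (hG p₀)
  obtain ⟨l₂, hl20, hpl02⟩ := exists_adj_ne (a := l₀) (hG p₀)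
  obtain ⟨p₁, hp10, hlp01⟩ := exists_adj_ne (a := p₀) (hG l₀)
  obtain ⟨p₂, hp20, hlp22⟩ := exists_adj_ne (a := p₀) (hG l₂)
  have hl₀ := hS hp₀ hpl00
  have hl₂ := hS hp₀ hpl02
  have hp₁ := hT hl₀ hlp01
  have hp₂ := hT hl₂ hlp22
  have hp12 : p₁ ≠ p₂ := fun e => hp10 (h.unique hl20 hlp22 (e ▸ hlp01) hpl02.symm hpl00.symm ▸ e)
  -- The path p₁ l₀ p₀ l₂ p₂ is closed to a hexagon by a common neighbour of its two ends.
  obtain ⟨l₁, hpl11, hpl21⟩ := (hSl hp₁ hp₂).resolve_left hp12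
  have hl₁ := hS hp₁ hpl11
  have n0 := neighborSet_eq_pair (hG p₀) hl20.symm hpl00 hpl02
  have m0 := neighborSet_eq_pair (hG l₀) hp10.symm hpl00.symm hlp01
  have m2 := neighborSet_eq_pair (hG l₂) hp20.symm hpl02.symm hlp22
  have hl10 : l₁ ≠ l₀ := fun e => by
    rcases (m0 p₂).1 (e ▸ hpl21.symm) with e | e
    · exact hp20 e
    · exact hp12 e.symm
  have hl12 : l₁ ≠ l₂ := fun e => by
    rcases (m2 p₁).1 (e ▸ hpl11.symm) with e | e
    · exact hp10 e
    · exact hp12 e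
  have n1 := neighborSet_eq_pair (hG p₁) hl10.symm hlp01.symm hpl11
  have n2 := neighborSet_eq_pair (hG p₂) hl12 hpl21 hlp22.symm
  have m1 := neighborSet_eq_pair (hG l₁) hp12 hpl11.symm hpl21.symm
  have hall := hconn.forall_mem_of_adj (S := {p₀, l₀, p₁, l₁, p₂, l₂}) (v := p₀) (by simp) (by
    rintro a b (rfl | rfl | rfl | rfl | rfl | rfl) hab
    · rcases (n0 b).1 hab with rfl | rfl <;> simp
    · rcases (m0 b).1 hab with rfl | rfl <;> simp
    · rcases (n1 b).1 hab with rfl | rfl <;> simp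
    · rcases (m1 b).1 hab with rfl | rfl <;> simp
    · rcases (n2 b).1 hab with rfl | rfl <;> simp
    · rcases (m2 b).1 hab with rfl | rfl <;> simp)
  have d00 := hdisj hp₀ hl₀
  have d01 := hdisj hp₀ hl₁
  have d02 := hdisj hp₀ hl₂
  have d10 := hdisj hp₁ hl₀
  have d11 := hdisj hp₁ hl₁
  have d12 := hdisj hp₁ hl₂
  have d20 := hdisj hp₂ hl₀
  have d21 := hdisj hp₂ hl₁
  have d22 := hdisj hp₂ hl₂
  have hinj : Function.Injective ![p₀, l₀, p₁, l₁, p₂, l₂] := by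
    intro i j
    fin_cases i <;> fin_cases j <;>
      simp [d00, d01, d02, d10, d11, d12, d20, d21, d22, d00.symm, d01.symm, d02.symm, d10.symm,
        d11.symm, d12.symm, d20.symm, d21.symm, d22.symm, hl20, hl20.symm, hp10, hp10.symm, hp20,
        hp20.symm, hp12, hp12.symm, hl10, hl10.symm, hl12, hl12.symm]
  refine ⟨Iso.symm ⟨Equiv.ofBijective ![p₀, l₀, p₁, l₁, p₂, l₂] ⟨hinj, ?_⟩, ?_⟩⟩
  · intro x
    rcases hall x with rfl | rfl | rfl | rfl | rfl | rfl
    exacts [⟨0, rfl⟩, ⟨1, rfl⟩, ⟨2, rfl⟩, ⟨3, rfl⟩, ⟨4, rfl⟩, ⟨5, rfl⟩]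
  · intro i j
    change G.Adj (![p₀, l₀, p₁, l₁, p₂, l₂] i) (![p₀, l₀, p₁, l₁, p₂, l₂] j) ↔ _
    -- Indices are cyclic in `Fin 6`, so injectivity reduces the claim to a finite check on indices.
    have hadj : ∀ i, G.Adj (![p₀, l₀, p₁, l₁, p₂, l₂] i) (![p₀, l₀, p₁, l₁, p₂, l₂] j) ↔
        ![p₀, l₀, p₁, l₁, p₂, l₂] j = ![p₀, l₀, p₁, l₁, p₂, l₂] (i + 1) ∨
          ![p₀, l₀, p₁, l₁, p₂, l₂] j = ![p₀, l₀, p₁, l₁, p₂, l₂] (i - 1) := by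
      intro i
      generalize ![p₀, l₀, p₁, l₁, p₂, l₂] j = y
      fin_cases i
      · exact n0 y
      · exact (m0 y).trans or_comm
      · exact (n1 y).trans or_comm
      · exact (m1 y).trans or_comm
      · exact (n2 y).trans or_comm
      · exact m2 y
    rw [hadj, hinj.eq_iff, hinj.eq_iff]
    clear hadj
    revert i j
    decide

/-- Classification of the connected regular graphs that are locally projective. -/
theorem IsLocallyProjective.classification [Finite V] (hconn : G.Connected)
    (h : G.IsLocallyProjective) (hG : ∀ v, (G.neighborSet v).ncard = k) (hk : 2 ≤ k) :
    (3 ≤ k ∧ IsPlaneIncidenceGraph (k - 1) V G) ∨ (k = 2 ∧ IsTriangleOrHexagon V G) := by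
  classical
  obtain ⟨v⟩ := hconn.nonempty
  obtain ⟨w, hvw⟩ : (G.neighborSet v).Nonempty :=
    Set.nonempty_of_ncard_ne_zero (by rw [hG v]; omega)
  have hvw : G.Adj v w := hvw
  let S : Set V := {a | G.Linked v a}
  let T : Set V := {a | G.Linked w a}
  have hS : ∀ ⦃a b⦄, a ∈ S → G.Adj a b → b ∈ T := fun a b ha hab => h.linked_of_adj ha hvw hab
  have hT : ∀ ⦃a b⦄, a ∈ T → G.Adj a b → b ∈ S := fun a b ha hab => h.linked_of_adj ha hvw.symm hab
  have hSl : ∀ ⦃a b⦄, a ∈ S → b ∈ S → G.Linked a b := fun a b ha hb => h.trans ha.symm hb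
  have hTl : ∀ ⦃a b⦄, a ∈ T → b ∈ T → G.Linked a b := fun a b ha hb => h.trans ha.symm hb
  have hvS : v ∈ S := Or.inl rfl
  have hall : ∀ x, x ∈ S ∪ T := hconn.forall_mem_of_adj (v := v) (Or.inl hvS) (by
    rintro a b (ha | ha) hab
    · exact Or.inr (hS ha hab)
    · exact Or.inl (hT ha hab))
  -- The classes of the two ends of an edge either coincide, and then all vertices are linked, or
  -- are disjoint and form a bipartition.
  by_cases hl : G.Linked v w
  · have hTS : ∀ x, x ∈ S := fun x => (hall x).elim id fun hx => h.trans hl hx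
    have hl' : ∀ a b, G.Linked a b := fun a b => hSl (hTS a) (hTS b)
    have := Fintype.ofFinite V
    have : Nonempty V := ⟨v⟩
    have hreg : G.IsRegularOfDegree k := fun a => by
      rw [← hG a, ← card_neighborFinset_eq_degree, Set.ncard_eq_toFinset_card', neighborFinset]
    obtain rfl := hreg.eq_two_of_friendship hk h.unique hl'
    exact Or.inr ⟨rfl, Or.inl (hconn.nonempty_iso_cycleGraph_three hG hl')⟩
  · have hdisj : Disjoint S T := Set.disjoint_left.2 fun x hx hx' =>
      hl (h.trans hx (Linked.symm hx'))
    rcases hk.lt_or_eq with hk3 | rfl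
    · exact Or.inl ⟨hk3, h.isPlaneIncidenceGraph hG hk3
        ⟨hdisj, codisjoint_iff.2 (Set.eq_univ_of_forall hall)⟩ ⟨v, hvS⟩ hS hT hSl hTl⟩
    · exact Or.inr ⟨rfl, Or.inr (h.nonempty_iso_cycleGraph_six hconn hG hdisj ⟨v, hvS⟩ hS hT hSl)⟩

/-! ### Reduction to connected components -/

section Components

variable (G) in
/-- A graph is the disjoint union of its connected components. -/
def isoDisjointUnionComponents :
    G ≃g disjointUnion fun c : G.ConnectedComponent => G.induce c.supp where
  toFun v := ⟨G.connectedComponentMk v, v, rfl⟩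
  invFun x := x.2.1
  left_inv _ := rfl
  right_inv := by
    rintro ⟨_, v, rfl⟩
    rfl
  map_rel_iff' := by
    intro a b
    change (disjointUnion _).Adj ⟨_, _⟩ ⟨_, _⟩ ↔ _
    rw [disjointUnion_adj_mk]
    constructor
    · rintro ⟨⟨b', hb'⟩, h, hab⟩
      have : b = b' := congrArg (fun x => x.2.1) h
      subst this
      exact hab
    · intro hab
      have hb : G.connectedComponentMk a = G.connectedComponentMk b :=
        ConnectedComponent.sound hab.reachable
      -- The component is generalized to a variable so that the equality of dependent pairs can be
      -- proved by substitution.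
      have key : ∀ (c : G.ConnectedComponent) (hc : G.connectedComponentMk b = c),
          (⟨_, b, rfl⟩ : Σ c : G.ConnectedComponent, c.supp) = ⟨c, b, hc⟩ := by
        rintro _ rfl
        rfl
      exact ⟨⟨b, hb.symm⟩, key _ hb.symm, hab⟩

theorem ConnectedComponent.linked_induce_supp {c : G.ConnectedComponent} {a b : c.supp} :
    (G.induce c.supp).Linked a b ↔ G.Linked a b := by
  refine or_congr Subtype.ext_iff ⟨?_, ?_⟩
  · rintro ⟨d, h1, h2⟩
    exact ⟨d, h1, h2⟩
  · rintro ⟨d, h1, h2⟩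
    exact ⟨⟨d, c.mem_supp_of_adj_mem_supp a.2 h1⟩, h1, h2⟩

theorem IsLocallyProjective.induce_supp (h : G.IsLocallyProjective) (c : G.ConnectedComponent) :
    (G.induce c.supp).IsLocallyProjective where
  unique _ _ _ _ huv h1 h2 h3 h4 :=
    Subtype.ext (h.unique (fun e => huv (Subtype.ext e)) h1 h2 h3 h4)
  trans _ _ _ h1 h2 := ConnectedComponent.linked_induce_supp.2
    (h.trans (ConnectedComponent.linked_induce_supp.1 h1) (ConnectedComponent.linked_induce_supp.1 h2))

theorem ConnectedComponent.ncard_neighborSet_induce_supp (c : G.ConnectedComponent) (v : c.supp) :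
    ((G.induce c.supp).neighborSet v).ncard = (G.neighborSet v).ncard := by
  rw [← Set.ncard_image_of_injective _ Subtype.val_injective]
  congr 1
  ext x
  constructor
  · rintro ⟨y, hy, rfl⟩
    exact hy
  · exact fun hx => ⟨⟨x, c.mem_supp_of_adj_mem_supp v.2 hx⟩, hx, rfl⟩

/-- Both conditions defining local projectivity can be tested on components. All components have the
same degree k, so they all fall in the same case of the classification. -/
theorem IsRegularOfDegree.isLocallyProjective_iff [Fintype V] [DecidableRel G.Adj]
    (hG : G.IsRegularOfDegree k) (hk : 2 ≤ k) :
    G.IsLocallyProjective ↔ G.IsDisjointUnionOf (IsPlaneIncidenceGraph (k - 1)) ∨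
      (k = 2 ∧ G.IsDisjointUnionOf IsTriangleOrHexagon) := by
  constructor
  · intro h
    have hncard : ∀ v, (G.neighborSet v).ncard = k := fun v => by
      classical
      rw [← hG.degree_eq v, ← card_neighborFinset_eq_degree, Set.ncard_eq_toFinset_card',
        neighborFinset]
    have hclass : ∀ c : G.ConnectedComponent, _ := fun c =>
      (h.induce_supp c).classification c.connected_toSimpleGraph
        (fun v => (c.ncard_neighborSet_induce_supp v).trans (hncard v)) hk
    rcases hk.lt_or_eq with hk3 | rfl
    · exact Or.inl ⟨_, _, _, fun c => ((hclass c).resolve_right fun h => by omega).2,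
        ⟨G.isoDisjointUnionComponents⟩⟩
    · exact Or.inr ⟨rfl, _, _, _, fun c => ((hclass c).resolve_left fun h => by omega).2,
        ⟨G.isoDisjointUnionComponents⟩⟩
  · rintro (h | ⟨-, h⟩)
    · exact h.isLocallyProjective fun _ _ hK => hK.isLocallyProjective
    · refine h.isLocallyProjective fun _ _ hK => ?_
      rcases hK with ⟨⟨f⟩⟩ | ⟨⟨f⟩⟩
      · exact isLocallyProjective_cycleGraph_three.of_iso f
      · exact isLocallyProjective_cycleGraph_six.of_iso f

end Components

end SimpleGraph

theorem theorem1 {V : Type u} [Fintype V] [DecidableEq V] (G : SimpleGraph V)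
    [DecidableRel G.Adj] (k n : ℕ) (hk : 2 ≤ k) (hn : k ^ 2 - k + 1 ≤ n)
    (hcard : Fintype.card V = n) (hG : G.IsRegularOfDegree k) :
    G.energy ≤ (√((k : ℝ) - 1) + 1 / ((k : ℝ) + √((k : ℝ) - 1))) * (n : ℝ) ∧
    (G.energy = (√((k : ℝ) - 1) + 1 / ((k : ℝ) + √((k : ℝ) - 1))) * (n : ℝ) ↔
      G.IsDisjointUnionOf (SimpleGraph.IsPlaneIncidenceGraph (k - 1)) ∨
      (k = 2 ∧ G.IsDisjointUnionOf SimpleGraph.IsTriangleOrHexagon)) := by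
  subst hcard
  exact ⟨(hG.energy_le_and_eq_iff hk).1, (hG.energy_eq_iff hk).trans (hG.isLocallyProjective_iff hk)⟩
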